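/- Let $C$ be a smooth ($C^\infty$, finite-dimensional, Hausdorff, second countable) manifold without boundary and let $p:E\to C$ be a smooth real vector bundle of finite rank. Identify $C$ with the image of the zero section in $E$. Let $W$ be an open neighbourhood of $C$ in $E$ and let $f:W\to\mathbb{R}$ be a Morse–Bott function, that is, $f$ is smooth and the set of its critical points is the union of an at most countable, locally finite family of mutually disjoint embedded submanifolds $C_i\subset W$ such that for every $i$ and every $x\in C_i$ the Hessian of $f$ at $x$ is non-degenerate in the direction transversal to $C_i$ (its null space is $T_xC_i$). Suppose that $f^{-1}(0)=C$ and that $C$ is exactly the set of all critical points of $f$. Then there exist an open neighbourhood $A\subset W$ of $C$ in $E$ and a local Ehresmann connection over $A$, that is, a smooth vector bundle morphism $\kappa:TA\to VA$ over the identity of $A$ with $\kappa|_{VA}=\mathrm{id}$, where $VA\subset TA$ is the bundle of vectors tangent to the fibres of $p$ (i.e. $VA=\ker dp|_{TA}$), such that the horizontal bundle $\ker\kappa$ is contained in the kernels of the differential of $f$: $\ker\kappa_z\subset\ker d_zf$ for all $z\in A$. -/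

import Mathlib

open Set Bundle Topology
open scoped Manifold ContDiff

noncomputable section

section MorseBott

variable {V : Type*} [NormedAddCommGroup V] [NormedSpace ℝ V]
  {H : Type*} [TopologicalSpace H] (I : ModelWithCorners ℝ V H)
  {M : Type*} [TopologicalSpace M] [ChartedSpace H M]

/-- `S` is an embedded smooth submanifold of `M` (its connected components may have different
dimensions): around each point of `S` there is a smooth chart of `M` in which `S` is cut out by a
linear subspace of the model vector space. -/
def IsEmbeddedSubmanifold (S : Set M) : Prop :=
  ∀ x ∈ S, ∃ φ ∈ IsManifold.maximalAtlas I ∞ M, x ∈ φ.source ∧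
    ∃ K : Submodule ℝ V, ∀ y ∈ φ.source, (y ∈ S ↔ φ.extend I y ∈ K)

/-- The vectors at `x` tangent to `S`: velocities at time `0` of curves in `M` that start at `x`
and stay in `S`. For an embedded submanifold `S` and `x ∈ S` this is the tangent space of `S`
at `x`. -/
def tangentVectors (S : Set M) (x : M) : Set (TangentSpace I x) :=
  {v | ∃ γ : ℝ → M, (∀ᶠ t in 𝓝 (0 : ℝ), γ t ∈ S) ∧ MDifferentiableAt 𝓘(ℝ, ℝ) I γ 0 ∧
    (⟨γ 0, mfderiv 𝓘(ℝ, ℝ) I γ 0 (1 : ℝ)⟩ : TangentBundle I M) = ⟨x, v⟩}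

/-- The critical points of `f` in the open set `W`. -/
def criticalSet (f : M → ℝ) (W : Set M) : Set M :=
  {x ∈ W | mfderiv I 𝓘(ℝ, ℝ) f x = 0}

/-- The Hessian of `f` at `x`: the second derivative of `f` read in the preferred chart at `x`,
which is the chart through which Mathlib identifies `TangentSpace I x` with the model space.
At a critical point this bilinear form does not depend on the chart. -/
def hessian (f : M → ℝ) (x : M) : TangentSpace I x →L[ℝ] TangentSpace I x →L[ℝ] ℝ :=
  (fderiv ℝ (fderiv ℝ (f ∘ (extChartAt I x).symm)) (extChartAt I x x) : V →L[ℝ] V →L[ℝ] ℝ)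

/-- `f`, restricted to the open subset `W` of a manifold without boundary, is a Morse-Bott
function: it is smooth on `W`, and its critical set in `W` is the union of an at most countable
family, locally finite in `W`, of mutually disjoint submanifolds (the family is indexed by `ℕ`;
some members may be empty), such that at each point `x` of the `i`-th one the Hessian is
nondegenerate in the transversal direction, i.e. its null space is exactly `T_x (S i)`. -/
structure IsMorseBottOn [I.Boundaryless] (f : M → ℝ) (W : Set M) : Prop where
  smooth : ContMDiffOn I 𝓘(ℝ, ℝ) ∞ f W
  exists_submanifolds : ∃ S : ℕ → Set M,
    criticalSet I f W = ⋃ i, S i ∧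
    Pairwise (fun i j => Disjoint (S i) (S j)) ∧
    (∀ x ∈ W, ∃ t ∈ 𝓝 x, {i | (S i ∩ t).Nonempty}.Finite) ∧
    (∀ i, IsEmbeddedSubmanifold I (S i)) ∧
    ∀ i, ∀ x ∈ S i, ∀ v : TangentSpace I x,
      (∀ w : TangentSpace I x, hessian I f x v w = 0) ↔ v ∈ tangentVectors I (S i) x

end MorseBott

section Ehresmann

variable {V : Type*} [NormedAddCommGroup V] [NormedSpace ℝ V]
  {H : Type*} [TopologicalSpace H] (I : ModelWithCorners ℝ V H)
  {C : Type*} [TopologicalSpace C] [ChartedSpace H C]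
  (F : Type*) [NormedAddCommGroup F] [NormedSpace ℝ F]
  {E : C → Type*} [TopologicalSpace (TotalSpace F E)]
  [∀ x, TopologicalSpace (E x)] [FiberBundle F E]
  [IsManifold I ∞ C] [∀ x, AddCommGroup (E x)] [∀ x, Module ℝ (E x)]
  [VectorBundle ℝ F E] [ContMDiffVectorBundle ∞ F E I]

/-- The vertical space at `z`: the tangent space of the fibre through `z`, i.e. the kernel of the
differential of the bundle projection. -/
def verticalSpace (z : TotalSpace F E) : Submodule ℝ (TangentSpace (I.prod 𝓘(ℝ, F)) z) :=
  LinearMap.ker (mfderiv (I.prod 𝓘(ℝ, F)) I (π F E) z).toLinearMap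

/-- A local Ehresmann connection over an open subset `A` of the total space: a smooth bundle
map of `T A` over the identity of `A`, linear on each tangent space, which takes values in the
vertical spaces and is the identity on them. (The values of `proj` off `A` are irrelevant.) -/
structure LocalEhresmannConnection (A : Set (TotalSpace F E)) where
  proj : ∀ z : TotalSpace F E,
    TangentSpace (I.prod 𝓘(ℝ, F)) z →L[ℝ] TangentSpace (I.prod 𝓘(ℝ, F)) z
  smooth : ContMDiffOn (I.prod 𝓘(ℝ, F)).tangent (I.prod 𝓘(ℝ, F)).tangent ∞
    (fun p : TangentBundle (I.prod 𝓘(ℝ, F)) (TotalSpace F E) =>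
      (⟨p.proj, proj p.proj p.snd⟩ : TangentBundle (I.prod 𝓘(ℝ, F)) (TotalSpace F E)))
    {p | p.proj ∈ A}
  mem_vertical : ∀ z ∈ A, ∀ v, proj z v ∈ verticalSpace I F z
  apply_vertical : ∀ z ∈ A, ∀ v ∈ verticalSpace I F z, proj z v = v

variable {I F} in
/-- The horizontal space at `z` of a local Ehresmann connection: the kernel of the projection. -/
def LocalEhresmannConnection.horizontalSpace {A : Set (TotalSpace F E)}
    (κ : LocalEhresmannConnection I F A) (z : TotalSpace F E) :
    Submodule ℝ (TangentSpace (I.prod 𝓘(ℝ, F)) z) :=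
  LinearMap.ker (κ.proj z).toLinearMap

end Ehresmann

end

/-! It suffices to find, near the zero section, a smooth projection `κ` onto the vertical bundle
with `df ∘ κ = df`: then `κ v = 0` forces `df v = 0`. Work in a bundle chart with base coordinate
`x` and fibre coordinate `y`, and let `g` be `f` in this chart. Since `dg` vanishes on `y = 0`,
Hadamard's formula writes `dg` at `(x, y)` as `e ↦ N(x, y)(e)(y)`, with `N` smooth and equal to the
Hessian paired with vertical vectors when `y = 0`. The null space of the Hessian is tangent to the
zero section, so the restriction `B` of `N` to vertical `e` is invertible near `y = 0`. Then `κ =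
B⁻¹ N` is the identity on vertical vectors, and `N κ = N` gives `dg ∘ κ = dg`. This is
`exists_vertical_proj_of_nondegenerate`, moved to the bundle by `exists_local_verticalProjection`.
The conditions on `κ` are affine, so a partition of unity glues the local solutions
(`exists_verticalProjection_of_local`). -/

noncomputable section

/-! ### Parametric integrals and the construction in coordinates. -/

section Calculus
universe u

theorem hasFDerivAt_intervalIntegral_param {X Y : Type*} [NormedAddCommGroup X] [NormedSpace ℝ X]
    [NormedAddCommGroup Y] [NormedSpace ℝ Y] [CompleteSpace Y]
    {h : X × ℝ → Y} (hh : ContDiff ℝ 1 h) (a b : ℝ) (x₀ : X) :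
    HasFDerivAt (fun x => ∫ t in a..b, h (x, t))
      (∫ t in a..b, (fderiv ℝ h (x₀, t)).comp (ContinuousLinearMap.inl ℝ X ℝ)) x₀ := by
  have hcont : Continuous fun q : X × ℝ =>
      (fderiv ℝ h q).comp (ContinuousLinearMap.inl ℝ X ℝ) :=
    (hh.continuous_fderiv one_ne_zero).clm_comp continuous_const
  obtain ⟨B, hB⟩ : ∃ B : ℝ, ∀ t ∈ uIcc a b,
      ‖(fderiv ℝ h (x₀, t)).comp (ContinuousLinearMap.inl ℝ X ℝ)‖ ≤ B :=
    (isCompact_uIcc (a := a) (b := b)).exists_bound_of_continuousOn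
      (hcont.comp (by fun_prop : Continuous fun t : ℝ => (x₀, t))).continuousOn
  -- `B` bounds the derivative only at `x₀`; compactness of the interval gives the bound `B + 1` on
  -- one neighbourhood of `x₀` for all `t`.
  have hnhds : ∀ᶠ x in 𝓝 x₀, ∀ t ∈ uIcc a b,
      ‖(fderiv ℝ h (x, t)).comp (ContinuousLinearMap.inl ℝ X ℝ)‖ < B + 1 := by
    refine isCompact_uIcc.eventually_forall_of_forall_eventually fun t ht => ?_
    exact (hcont.norm.tendsto (x₀, t)).eventually_lt_const
      (lt_of_le_of_lt (hB t ht) (lt_add_one B))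
  refine (intervalIntegral.hasFDerivAt_integral_of_dominated_of_fderiv_le
    (F := fun x t => h (x, t))
    (F' := fun x t => (fderiv ℝ h (x, t)).comp (ContinuousLinearMap.inl ℝ X ℝ))
    (bound := fun _ => B + 1) hnhds ?_ ?_ ?_ ?_ ?_ ?_)
  · exact Filter.Eventually.of_forall fun x =>
      (hh.continuous.comp (by fun_prop : Continuous fun t : ℝ => (x, t))).aestronglyMeasurable
  · exact (hh.continuous.comp
      (by fun_prop : Continuous fun t : ℝ => (x₀, t))).intervalIntegrable _ _
  · exact (hcont.comp (by fun_prop : Continuous fun t : ℝ => (x₀, t))).aestronglyMeasurable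
  · exact Filter.Eventually.of_forall fun t ht x hx => (hx t (uIoc_subset_uIcc ht)).le
  · exact intervalIntegrable_const
  · refine Filter.Eventually.of_forall fun t _ x _ => ?_
    exact ((hh.differentiable one_ne_zero (x, t)).hasFDerivAt).comp x (hasFDerivAt_prodMk_left x t)

/-- Induction by differentiating under the integral. The derivative takes values in `X →L[ℝ] Y`, so
`Y` varies in the induction, and sharing the universe of `X` keeps it in the same universe. -/
theorem contDiff_nat_intervalIntegral_param {X : Type u} [NormedAddCommGroup X] [NormedSpace ℝ X]
    (a b : ℝ) (n : ℕ) : ∀ {Y : Type u} [NormedAddCommGroup Y] [NormedSpace ℝ Y] [CompleteSpace Y]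
    {h : X × ℝ → Y}, ContDiff ℝ n h → ContDiff ℝ n (fun x => ∫ t in a..b, h (x, t)) := by
  induction n with
  | zero =>
    intro Y _ _ _ h hh
    rw [Nat.cast_zero, contDiff_zero] at hh ⊢
    exact intervalIntegral.continuous_parametric_intervalIntegral_of_continuous'
      (f := fun x t => h (x, t)) hh a b
  | succ n ih =>
    intro Y _ _ _ h hh
    have h1 : ContDiff ℝ 1 h := hh.of_le (by exact_mod_cast Nat.le_add_left 1 n)
    have key := fun x₀ => hasFDerivAt_intervalIntegral_param h1 a b x₀
    push_cast at hh ⊢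
    rw [contDiff_succ_iff_fderiv] at hh ⊢
    refine ⟨fun x => (key x).differentiableAt, by simp, ?_⟩
    rw [show fderiv ℝ (fun x => ∫ t in a..b, h (x, t)) = _ from funext fun x => (key x).fderiv]
    exact ih (hh.2.2.clm_comp contDiff_const)

/-- An integral over a compact interval depends smoothly on parameters. -/
theorem ContDiff.intervalIntegral_param {X Y : Type u} [NormedAddCommGroup X] [NormedSpace ℝ X]
    [NormedAddCommGroup Y] [NormedSpace ℝ Y] [CompleteSpace Y] {h : X × ℝ → Y}
    (hh : ContDiff ℝ ∞ h) (a b : ℝ) : ContDiff ℝ ∞ (fun x => ∫ t in a..b, h (x, t)) :=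
  contDiff_infty.2 fun n => contDiff_nat_intervalIntegral_param a b n (contDiff_infty.1 hh n)

/-- A function smooth near a point agrees near that point with a globally smooth function. -/
theorem ContDiffOn.exists_contDiff_eventuallyEq {X Y : Type*} [NormedAddCommGroup X]
    [NormedSpace ℝ X] [FiniteDimensional ℝ X] [NormedAddCommGroup Y] [NormedSpace ℝ Y]
    {g : X → Y} {s : Set X} {x₀ : X} (hg : ContDiffOn ℝ ∞ g s) (hs : s ∈ 𝓝 x₀) :
    ∃ g' : X → Y, ContDiff ℝ ∞ g' ∧ g' =ᶠ[𝓝 x₀] g := by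
  obtain ⟨ε, hε, hball⟩ := Metric.nhds_basis_closedBall.mem_iff.1 (interior_mem_nhds.2 hs)
  let χ : ContDiffBump x₀ := ⟨ε / 2, ε, half_pos hε, half_lt_self hε⟩
  have hχ : tsupport χ ⊆ interior s := χ.tsupport_eq.trans_subset hball
  refine ⟨fun x => χ x • g x, contDiff_iff_contDiffAt.2 fun x => ?_, ?_⟩
  · by_cases hx : x ∈ tsupport χ
    · exact χ.contDiff.contDiffAt.smul (hg.contDiffAt (mem_interior_iff_mem_nhds.1 (hχ hx)))
    · refine contDiffAt_const (c := (0 : Y)) |>.congr_of_eventuallyEq ?_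
      filter_upwards [(isClosed_tsupport χ).isOpen_compl.mem_nhds hx] with y hy
      rw [image_eq_zero_of_notMem_tsupport hy, zero_smul]
  · filter_upwards [χ.eventuallyEq_one] with x hx
    simp [hx]

set_option synthInstance.maxHeartbeats 100000 in
theorem ContDiff.clm_flip {T X Y Z : Type*} [NormedAddCommGroup T] [NormedSpace ℝ T]
    [NormedAddCommGroup X] [NormedSpace ℝ X] [NormedAddCommGroup Y] [NormedSpace ℝ Y]
    [NormedAddCommGroup Z] [NormedSpace ℝ Z] {f : T → X →L[ℝ] Y →L[ℝ] Z} {n : ℕ∞ω}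
    (hf : ContDiff ℝ n f) : ContDiff ℝ n fun t => (f t).flip := by
  have h : IsBoundedLinearMap ℝ fun g : X →L[ℝ] Y →L[ℝ] Z => g.flip :=
    { map_add := fun _ _ => rfl
      map_smul := fun _ _ => rfl
      bound := ⟨1, one_pos, fun g => by simp⟩ }
  exact (IsBoundedLinearMap.contDiff (E := X →L[ℝ] Y →L[ℝ] Z) (F := Y →L[ℝ] X →L[ℝ] Z) h).comp hf

theorem ContinuousLinearMap.isInvertible_dual_of_injective {F : Type*} [NormedAddCommGroup F]
    [NormedSpace ℝ F] [FiniteDimensional ℝ F] {B : F →L[ℝ] F →L[ℝ] ℝ}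
    (hB : Function.Injective B) : B.IsInvertible := by
  have hdim : Module.finrank ℝ F = Module.finrank ℝ (F →L[ℝ] ℝ) :=
    (Subspace.dual_finrank_eq (K := ℝ) (V := F)).symm.trans
      (LinearMap.toContinuousLinearMap (𝕜 := ℝ) (E := F) (F' := ℝ)).finrank_eq
  exact ⟨(LinearEquiv.ofInjectiveOfFinrankEq B.toLinearMap hB hdim).toContinuousLinearEquiv, rfl⟩

/-- The Hadamard argument: solve `B(q) u = N(q) e` for the vertical vector `u` instead of dividing
by `dg`, which vanishes on the zero section. -/
theorem exists_vertical_proj_of_nondegenerate {X F : Type*} [NormedAddCommGroup X]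
    [NormedSpace ℝ X]
    [FiniteDimensional ℝ X] [NormedAddCommGroup F] [NormedSpace ℝ F] [FiniteDimensional ℝ F]
    {g : X × F → ℝ} {x₀ : X} {s : Set (X × F)} (hg : ContDiffOn ℝ ∞ g s) (hs : s ∈ 𝓝 (x₀, (0 : F)))
    (hcrit : ∀ᶠ x in 𝓝 x₀, fderiv ℝ g (x, 0) = 0)
    (hnd : ∀ w : F, (∀ e, fderiv ℝ (fderiv ℝ g) (x₀, 0) (0, w) e = 0) → w = 0) :
    ∃ K : X × F → (X × F →L[ℝ] X × F), ∀ᶠ q in 𝓝 (x₀, (0 : F)),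
      ContDiffAt ℝ ∞ K q ∧ (∀ e, (K q e).1 = 0) ∧ (∀ w, K q (0, w) = (0, w)) ∧
      ∀ e, fderiv ℝ g q (K q e) = fderiv ℝ g q e := by
  -- Only the germ at `(x₀, 0)` matters; with a global `g'` the integrals below are defined and
  -- smooth everywhere.
  obtain ⟨g', hg', hgg'⟩ := hg.exists_contDiff_eventuallyEq hs
  have hD1 : ∀ᶠ q in 𝓝 (x₀, (0 : F)), fderiv ℝ g' q = fderiv ℝ g q := hgg'.fderiv
  have hD2 : fderiv ℝ (fderiv ℝ g') (x₀, 0) = fderiv ℝ (fderiv ℝ g) (x₀, 0) :=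
    (hgg'.fderiv).fderiv_eq
  have hD : ContDiff ℝ ∞ (fderiv ℝ g') := hg'.fderiv_right (by simp)
  have hDD : ContDiff ℝ ∞ (fderiv ℝ (fderiv ℝ g')) := hD.fderiv_right (by simp)
  have hcrit' : ∀ᶠ x in 𝓝 x₀, fderiv ℝ g' (x, 0) = 0 := by
    have h1 : Filter.Tendsto (fun x : X => (x, (0 : F))) (𝓝 x₀) (𝓝 (x₀, 0)) :=
      (by fun_prop : Continuous fun x : X => (x, (0 : F))).tendsto x₀
    filter_upwards [hcrit, h1.eventually hD1] with x hx hx' using hx'.trans hx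
  -- Average of the Hessian along the fibre segment from `(q.1, 0)` to `q`.
  let P : X × F → (X × F →L[ℝ] X × F →L[ℝ] ℝ) := fun q =>
    ∫ t in (0 : ℝ)..1, fderiv ℝ (fderiv ℝ g') (q.1, t • q.2)
  have hP : ContDiff ℝ ∞ P :=
    ContDiff.intervalIntegral_param (h := fun p : (X × F) × ℝ =>
      fderiv ℝ (fderiv ℝ g') (p.1.1, p.2 • p.1.2)) (hDD.comp (by fun_prop)) 0 1
  have hPD : ∀ q : X × F, P q (0, q.2) = fderiv ℝ g' q - fderiv ℝ g' (q.1, 0) := by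
    intro q
    have hc : Continuous fun t : ℝ => fderiv ℝ (fderiv ℝ g') (q.1, t • q.2) :=
      hDD.continuous.comp (by fun_prop)
    rw [ContinuousLinearMap.intervalIntegral_apply (hc.intervalIntegrable _ _),
      intervalIntegral.integral_eq_sub_of_hasDerivAt
        (f := fun t : ℝ => fderiv ℝ g' (q.1, t • q.2))]
    · simp
    · intro t _
      refine ((hD.differentiable (by simp) (q.1, t • q.2)).hasFDerivAt).comp_hasDerivAt t ?_
      simpa using (hasDerivAt_const t q.1).prodMk ((hasDerivAt_id t).smul_const q.2)
    · exact (hc.clm_apply continuous_const).intervalIntegrable _ _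
  let N : X × F → (X × F →L[ℝ] F →L[ℝ] ℝ) := fun q =>
    ((P q).comp (ContinuousLinearMap.inr ℝ X F)).flip
  have hN : ContDiff ℝ ∞ N :=
    (hP.clm_comp contDiff_const).clm_flip
  let B : X × F → (F →L[ℝ] F →L[ℝ] ℝ) := fun q => (N q).comp (ContinuousLinearMap.inr ℝ X F)
  have hB : ContDiff ℝ ∞ B := hN.clm_comp contDiff_const
  -- `B (x₀, 0)` tests `w` against vertical vectors only, while `hnd` asks for all `e`. The mixed
  -- terms vanish because `dg'` is zero along the zero section, so its derivative in the base
  -- directions is zero too.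
  have hinj : Function.Injective (B (x₀, 0)) := by
    rw [injective_iff_map_eq_zero]
    intro w hw
    have hP0 : P (x₀, 0) = fderiv ℝ (fderiv ℝ g') (x₀, 0) := by simp [P]
    have hsymm : IsSymmSndFDerivAt ℝ g' (x₀, 0) :=
      hg'.contDiffAt.isSymmSndFDerivAt (by simpa using WithTop.coe_le_coe.2 (le_top : (2 : ℕ∞) ≤ ⊤))
    have hBw : ∀ v, fderiv ℝ (fderiv ℝ g') (x₀, 0) (0, v) (0, w) = 0 := fun v => by
      rw [← hP0]; exact DFunLike.congr_fun hw v
    refine hnd w fun e => ?_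
    rw [← hD2, show e = (e.1, 0) + (0, e.2) by simp, map_add, hsymm.eq (0, w) (0, e.2), hBw,
      add_zero, hsymm.eq (0, w) (e.1, 0)]
    have hx₀ : HasFDerivAt (fun x : X => fderiv ℝ g' (x, 0))
        ((fderiv ℝ (fderiv ℝ g') (x₀, 0)).comp (ContinuousLinearMap.inl ℝ X F)) x₀ :=
      ((hD.differentiable (by simp) (x₀, 0)).hasFDerivAt).comp x₀ (hasFDerivAt_prodMk_left x₀ 0)
    have h0 := hx₀.unique ((hasFDerivAt_const (0 : X × F →L[ℝ] ℝ) x₀).congr_of_eventuallyEq hcrit')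
    exact DFunLike.congr_fun (DFunLike.congr_fun h0 e.1) (0, w)
  have hinv : (B (x₀, 0)).IsInvertible :=
    ContinuousLinearMap.isInvertible_dual_of_injective hinj
  obtain ⟨e₀, he₀⟩ := hinv
  have hBe : ∀ᶠ q in 𝓝 (x₀, (0 : F)), (B q).IsInvertible :=
    hB.continuous.continuousAt.eventually (by rw [← he₀]; exact ContinuousLinearEquiv.nhds e₀)
  have hx : ∀ᶠ q : X × F in 𝓝 (x₀, (0 : F)), fderiv ℝ g' (q.1, 0) = 0 :=
    (continuous_fst.tendsto (x₀, (0 : F))).eventually hcrit'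
  refine ⟨fun q => (ContinuousLinearMap.inr ℝ X F).comp ((B q).inverse.comp (N q)), ?_⟩
  filter_upwards [hBe, hx, hD1] with q hq hxq hDq
  have hDN : ∀ e, fderiv ℝ g q e = N q e q.2 := by
    intro e
    rw [← hDq, ← sub_zero (fderiv ℝ g' q), ← hxq, ← hPD q]
    rfl
  refine ⟨?_, ?_, ?_, ?_⟩
  · obtain ⟨e, he⟩ := hq
    have : ContDiffAt ℝ ∞ (fun q => (B q).inverse) q := by
      refine ContDiffAt.comp q (g := ContinuousLinearMap.inverse) ?_ hB.contDiffAt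
      rw [← he]
      exact contDiffAt_map_inverse e
    exact contDiffAt_const.clm_comp (this.clm_comp hN.contDiffAt)
  · intro e; simp
  · intro w
    have : (B q).inverse (B q w) = w := hq.inverse_apply_self w
    exact Prod.ext rfl this
  · intro e
    have : B q ((B q).inverse (N q e)) = N q e := hq.self_apply_inverse (N q e)
    rw [hDN, hDN, ← this]
    rfl

end Calculus

/-! ### Fields of tangent endomorphisms read in a chart. -/

section ChartEndomorphism

variable {V : Type*} [NormedAddCommGroup V] [NormedSpace ℝ V]
  {H : Type*} [TopologicalSpace H] (I : ModelWithCorners ℝ V H)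
  {M : Type*} [TopologicalSpace M] [ChartedSpace H M] [IsManifold I ∞ M]

/-- The field of endomorphisms of the tangent spaces which reads `K` in the chart at `x₀`. -/
def chartEndomorphism (x₀ : M) (K : V → V →L[ℝ] V) (x : M) :
    TangentSpace I x →L[ℝ] TangentSpace I x :=
  ((trivializationAt V (TangentSpace I) x₀).symmL ℝ x).comp
    ((K (extChartAt I x₀ x)).comp
      ((trivializationAt V (TangentSpace I) x₀).continuousLinearMapAt ℝ x))

variable {I}

theorem mfderiv_extChartAt_chartEndomorphism {x₀ x : M} (hx : x ∈ (chartAt H x₀).source)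
    (K : V → V →L[ℝ] V) (v : TangentSpace I x) :
    mfderiv I 𝓘(ℝ, V) (extChartAt I x₀) x (chartEndomorphism I x₀ K x v) =
      K (extChartAt I x₀ x) (mfderiv I 𝓘(ℝ, V) (extChartAt I x₀) x v) := by
  rw [← TangentBundle.continuousLinearMapAt_trivializationAt hx]
  exact (trivializationAt V (TangentSpace I) x₀).continuousLinearMapAt_symmL
    (b := x) (by simpa using hx) _

theorem contMDiffAt_chartEndomorphism {x₀ x : M} (hx : x ∈ (chartAt H x₀).source)
    {K : V → V →L[ℝ] V} (hK : ContDiffAt ℝ ∞ K (extChartAt I x₀ x)) :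
    ContMDiffAt I (I.prod 𝓘(ℝ, V →L[ℝ] V)) ∞
      (fun y => TotalSpace.mk' (V →L[ℝ] V)
        (E := fun y : M => TangentSpace I y →L[ℝ] TangentSpace I y) y
        (chartEndomorphism I x₀ K y)) x := by
  have hx' : x ∈ (trivializationAt (V →L[ℝ] V)
      (fun y : M => TangentSpace I y →L[ℝ] TangentSpace I y) x₀).baseSet := by
    simpa [hom_trivializationAt_baseSet] using hx
  rw [(trivializationAt (V →L[ℝ] V)
      (fun y : M => TangentSpace I y →L[ℝ] TangentSpace I y) x₀).contMDiffAt_section_iff hx']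
  have h1 : ContMDiffAt I 𝓘(ℝ, V →L[ℝ] V) ∞ (fun y => K (extChartAt I x₀ y)) x :=
    hK.contMDiffAt.comp x (contMDiffAt_extChartAt' hx)
  refine h1.congr_of_eventuallyEq ?_
  filter_upwards [(chartAt H x₀).open_source.mem_nhds hx] with y hy
  have hy' : y ∈ (trivializationAt V (TangentSpace I) x₀).baseSet := by simpa using hy
  rw [hom_trivializationAt_apply]
  ext v
  simp only [ContinuousLinearMap.inCoordinates, chartEndomorphism,
    ContinuousLinearMap.comp_apply]
  rw [Trivialization.continuousLinearMapAt_symmL _ hy',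
    Trivialization.continuousLinearMapAt_symmL _ hy']

theorem mfderiv_eq_fderiv_comp_mfderiv_extChartAt [I.Boundaryless] {f : M → ℝ} {x₀ x : M}
    (hx : x ∈ (chartAt H x₀).source) (hf : MDifferentiableAt I 𝓘(ℝ, ℝ) f x) (v : TangentSpace I x) :
    mfderiv I 𝓘(ℝ, ℝ) f x v = fderiv ℝ (f ∘ (extChartAt I x₀).symm) (extChartAt I x₀ x)
      (mfderiv I 𝓘(ℝ, V) (extChartAt I x₀) x v) := by
  have hx' : x ∈ (extChartAt I x₀).source := by simpa using hx
  have hl : (extChartAt I x₀).symm (extChartAt I x₀ x) = x := (extChartAt I x₀).left_inv hx'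
  have h1 : MDifferentiableAt 𝓘(ℝ, V) I (extChartAt I x₀).symm (extChartAt I x₀ x) := by
    have := mdifferentiableWithinAt_extChartAt_symm (I := I) ((extChartAt I x₀).map_source hx')
    rwa [I.range_eq_univ, mdifferentiableWithinAt_univ] at this
  have h2 : MDifferentiableAt 𝓘(ℝ, V) 𝓘(ℝ, ℝ) (f ∘ (extChartAt I x₀).symm) (extChartAt I x₀ x) :=
    MDifferentiableAt.comp (extChartAt I x₀ x) (by rwa [hl]) h1
  have h3 : f =ᶠ[𝓝 x] (f ∘ (extChartAt I x₀).symm) ∘ extChartAt I x₀ := by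
    filter_upwards [extChartAt_source_mem_nhds' hx'] with y hy
    exact congrArg f ((extChartAt I x₀).left_inv hy).symm
  rw [h3.mfderiv_eq, mfderiv_comp x h2 (mdifferentiableAt_extChartAt hx), mfderiv_eq_fderiv]
  rfl

end ChartEndomorphism

/-! ### Bundle charts: projection, zero section and vertical space. -/

section VectorBundle

variable {V : Type*} [NormedAddCommGroup V] [NormedSpace ℝ V]
  {H : Type*} [TopologicalSpace H] {I : ModelWithCorners ℝ V H}
  {C : Type*} [TopologicalSpace C] [ChartedSpace H C]
  {F : Type*} [NormedAddCommGroup F] [NormedSpace ℝ F]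
  {E : C → Type*} [TopologicalSpace (TotalSpace F E)]
  [∀ x, TopologicalSpace (E x)] [FiberBundle F E]

theorem extChartAt_totalSpace_fst {z₀ z : TotalSpace F E}
    (hz : z ∈ (chartAt (ModelProd H F) z₀).source) :
    (extChartAt (I.prod 𝓘(ℝ, F)) z₀ z).1 = extChartAt I z₀.proj z.proj := by
  rw [FiberBundle.extChartAt]
  rw [FiberBundle.chartedSpace_chartAt] at hz
  simp only [mfld_simps] at hz ⊢
  rw [Trivialization.coe_fst _ hz.1]

omit [NormedSpace ℝ F] in
theorem mem_chartAt_totalSpace_source {z₀ z : TotalSpace F E} :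
    z ∈ (chartAt (ModelProd H F) z₀).source ↔
      z.proj ∈ (trivializationAt F E z₀.proj).baseSet ∧ z.proj ∈ (chartAt H z₀.proj).source := by
  rw [FiberBundle.chartedSpace_chartAt]
  simp only [mfld_simps]
  rw [Trivialization.mem_source]
  refine and_congr_right fun h => ?_
  rw [Trivialization.coe_fst' _ h]

variable [∀ x, AddCommGroup (E x)] [∀ x, Module ℝ (E x)] [VectorBundle ℝ F E]

theorem extChartAt_totalSpace_zeroSection {z₀ : TotalSpace F E} {x : C}
    (hx : zeroSection F E x ∈ (chartAt (ModelProd H F) z₀).source) :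
    extChartAt (I.prod 𝓘(ℝ, F)) z₀ (zeroSection F E x) = (extChartAt I z₀.proj x, 0) := by
  have h := mem_chartAt_totalSpace_source.1 hx
  refine Prod.ext (extChartAt_totalSpace_fst hx) ?_
  rw [FiberBundle.extChartAt]
  simp only [mfld_simps]
  exact congrArg Prod.snd (Trivialization.zeroSection ℝ (trivializationAt F E z₀.proj) (x := x) h.1)

variable [IsManifold I ∞ C] [ContMDiffVectorBundle ∞ F E I]

theorem mem_verticalSpace_iff {z₀ z : TotalSpace F E}
    (hz : z ∈ (chartAt (ModelProd H F) z₀).source) {v : TangentSpace (I.prod 𝓘(ℝ, F)) z} :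
    v ∈ verticalSpace I F z ↔
      (mfderiv (I.prod 𝓘(ℝ, F)) 𝓘(ℝ, V × F) (extChartAt (I.prod 𝓘(ℝ, F)) z₀) z v).1 = 0 := by
  have hzp := (mem_chartAt_totalSpace_source.1 hz).2
  have h1 : MDifferentiableAt I 𝓘(ℝ, V) (extChartAt I z₀.proj) z.proj :=
    mdifferentiableAt_extChartAt hzp
  have h2 : MDifferentiableAt (I.prod 𝓘(ℝ, F)) I (π F E) z :=
    (contMDiff_proj E (n := ∞) z).mdifferentiableAt (by simp)
  have h3 : MDifferentiableAt (I.prod 𝓘(ℝ, F)) 𝓘(ℝ, V × F) (extChartAt (I.prod 𝓘(ℝ, F)) z₀) z :=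
    mdifferentiableAt_extChartAt hz
  have h4 : extChartAt I z₀.proj ∘ π F E =ᶠ[𝓝 z] Prod.fst ∘ extChartAt (I.prod 𝓘(ℝ, F)) z₀ := by
    filter_upwards [(chartAt (ModelProd H F) z₀).open_source.mem_nhds hz] with y hy
    exact (extChartAt_totalSpace_fst hy).symm
  have h5 : MDifferentiableAt 𝓘(ℝ, V × F) 𝓘(ℝ, V) (Prod.fst : V × F → V)
      (extChartAt (I.prod 𝓘(ℝ, F)) z₀ z) := differentiableAt_fst.mdifferentiableAt
  have h6 := h4.mfderiv_eq (I := I.prod 𝓘(ℝ, F)) (I' := 𝓘(ℝ, V))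
  rw [mfderiv_comp z h1 h2, mfderiv_comp z h5 h3, mfderiv_eq_fderiv (f := (Prod.fst : V × F → V)),
    fderiv_fst] at h6
  have h7 : mfderiv I 𝓘(ℝ, V) (extChartAt I z₀.proj) z.proj (mfderiv (I.prod 𝓘(ℝ, F)) I (π F E) z v)
      = (mfderiv (I.prod 𝓘(ℝ, F)) 𝓘(ℝ, V × F) (extChartAt (I.prod 𝓘(ℝ, F)) z₀) z v).1 :=
    DFunLike.congr_fun h6 v
  have h8 := isInvertible_mfderiv_extChartAt (I := I) (x := z₀.proj) (y := z.proj)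
    (by simpa using hzp)
  rw [← h7]
  exact (map_eq_zero_iff _ h8.injective).symm

end VectorBundle

/-! ### Local existence of the projection. -/

section VerticalProjection

variable {V : Type*} [NormedAddCommGroup V] [NormedSpace ℝ V]
  {H : Type*} [TopologicalSpace H] {I : ModelWithCorners ℝ V H}
  {C : Type*} [TopologicalSpace C] [ChartedSpace H C]
  {F : Type*} [NormedAddCommGroup F] [NormedSpace ℝ F]
  {E : C → Type*} [TopologicalSpace (TotalSpace F E)]
  [∀ x, TopologicalSpace (E x)] [FiberBundle F E]
  [∀ x, AddCommGroup (E x)] [∀ x, Module ℝ (E x)] [VectorBundle ℝ F E]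

/-- A curve in the zero section has fibre coordinate constantly zero in a bundle chart, and the
chart at `z` is the one identifying the tangent space with `V × F`. -/
theorem snd_eq_zero_of_mem_tangentVectors {S : Set (TotalSpace F E)}
    (hS : S ⊆ range (zeroSection F E)) {z : TotalSpace F E}
    {v : TangentSpace (I.prod 𝓘(ℝ, F)) z}
    (hv : v ∈ tangentVectors (I.prod 𝓘(ℝ, F)) S z) : (show V × F from v).2 = 0 := by
  obtain ⟨γ, hγS, hγ, hγv⟩ := hv
  obtain rfl : γ 0 = z := congrArg TotalSpace.proj hγv
  rw [TotalSpace.mk_inj] at hγv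
  let L : ℝ →L[ℝ] V × F := mfderiv 𝓘(ℝ, ℝ) (I.prod 𝓘(ℝ, F)) γ 0
  have h1 : HasFDerivAt (extChartAt (I.prod 𝓘(ℝ, F)) (γ 0) ∘ γ) L 0 := by
    have h := hγ.hasMFDerivAt.2
    rw [ModelWithCorners.range_eq_univ] at h
    exact hasFDerivWithinAt_univ.1 h
  have h2 : HasFDerivAt (fun t => (extChartAt (I.prod 𝓘(ℝ, F)) (γ 0) (γ t)).2)
      ((ContinuousLinearMap.snd ℝ V F).comp L) 0 :=
    hasFDerivAt_snd.comp (0 : ℝ) h1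
  have h3 : (fun t => (extChartAt (I.prod 𝓘(ℝ, F)) (γ 0) (γ t)).2) =ᶠ[𝓝 0] fun _ => (0 : F) := by
    filter_upwards [hγS, hγ.continuousAt.eventually
      ((chartAt (ModelProd H F) (γ 0)).open_source.mem_nhds (mem_chart_source _ (γ 0)))]
      with t ht ht'
    obtain ⟨x, hx⟩ := hS ht
    rw [← hx] at ht' ⊢
    rw [extChartAt_totalSpace_zeroSection ht']
  have h4 := h2.unique ((hasFDerivAt_const (0 : F) (0 : ℝ)).congr_of_eventuallyEq h3)
  rw [← hγv]
  exact DFunLike.congr_fun h4 (1 : ℝ)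

variable [IsManifold I ∞ C] [ContMDiffVectorBundle ∞ F E I]

/-- A linear projection of the tangent space at `z` onto the vertical space which does not change
the differential of `f`. -/
structure IsVerticalProjectionPreserving (I : ModelWithCorners ℝ V H) [IsManifold I ∞ C]
    [ContMDiffVectorBundle ∞ F E I] (f : TotalSpace F E → ℝ)
    (z : TotalSpace F E)
    (κ : TangentSpace (I.prod 𝓘(ℝ, F)) z →L[ℝ] TangentSpace (I.prod 𝓘(ℝ, F)) z) : Prop where
  mem_vertical : ∀ v, κ v ∈ verticalSpace I F z
  apply_vertical : ∀ v ∈ verticalSpace I F z, κ v = v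
  mfderiv_apply : ∀ v, mfderiv (I.prod 𝓘(ℝ, F)) 𝓘(ℝ, ℝ) f z (κ v) =
    mfderiv (I.prod 𝓘(ℝ, F)) 𝓘(ℝ, ℝ) f z v

theorem exists_local_verticalProjection [I.Boundaryless] [FiniteDimensional ℝ V]
    [FiniteDimensional ℝ F] {W : Set (TotalSpace F E)} (hW : IsOpen W)
    {f : TotalSpace F E → ℝ} (hf : IsMorseBottOn (I.prod 𝓘(ℝ, F)) f W)
    (hcrit : criticalSet (I.prod 𝓘(ℝ, F)) f W = range (zeroSection F E)) (c : C) :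
    ∃ A : Set (TotalSpace F E), IsOpen A ∧ zeroSection F E c ∈ A ∧ A ⊆ W ∧
      ∃ κ : ∀ z : TotalSpace F E,
        TangentSpace (I.prod 𝓘(ℝ, F)) z →L[ℝ] TangentSpace (I.prod 𝓘(ℝ, F)) z,
        ∀ z ∈ A, IsVerticalProjectionPreserving I f z (κ z) ∧
          ContMDiffAt (I.prod 𝓘(ℝ, F)) ((I.prod 𝓘(ℝ, F)).prod 𝓘(ℝ, V × F →L[ℝ] V × F)) ∞
            (fun z => TotalSpace.mk' (V × F →L[ℝ] V × F)
              (E := fun z : TotalSpace F E => TangentSpace (I.prod 𝓘(ℝ, F)) z →L[ℝ]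
                TangentSpace (I.prod 𝓘(ℝ, F)) z) z (κ z)) z := by
  have : IsManifold (I.prod 𝓘(ℝ, F)) ∞ (TotalSpace F E) := inferInstance
  set z₀ : TotalSpace F E := zeroSection F E c with hz₀
  set φ := extChartAt (I.prod 𝓘(ℝ, F)) z₀ with hφ
  set g : V × F → ℝ := f ∘ φ.symm with hg
  have hzero : ∀ x, zeroSection F E x ∈ criticalSet (I.prod 𝓘(ℝ, F)) f W := fun x => by
    rw [hcrit]; exact mem_range_self x
  have hfz : ∀ z ∈ W, MDifferentiableAt (I.prod 𝓘(ℝ, F)) 𝓘(ℝ, ℝ) f z := fun z hz =>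
    (hf.smooth.contMDiffAt (hW.mem_nhds hz)).mdifferentiableAt (by simp)
  have hφz₀ : φ z₀ = (extChartAt I c c, 0) :=
    extChartAt_totalSpace_zeroSection (mem_chart_source _ z₀)
  have hgs : ContDiffOn ℝ ∞ g (φ.target ∩ φ.symm ⁻¹' W) := by
    rw [← contMDiffOn_iff_contDiffOn]
    exact hf.smooth.comp ((contMDiffOn_extChartAt_symm z₀).mono inter_subset_left)
      inter_subset_right
  have htarget : φ.target ∈ 𝓝 (φ z₀) := extChartAt_target_mem_nhds z₀
  have hs : φ.target ∩ φ.symm ⁻¹' W ∈ 𝓝 (φ z₀) :=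
    Filter.inter_mem htarget
      ((continuousAt_extChartAt_symm z₀).preimage_mem_nhds
        (by rw [extChartAt_to_inv]; exact hW.mem_nhds (hzero c).1))
  have hdg : ∀ z ∈ W, z ∈ (chartAt (ModelProd H F) z₀).source →
      ∀ v, mfderiv (I.prod 𝓘(ℝ, F)) 𝓘(ℝ, ℝ) f z v = fderiv ℝ g (φ z)
        (mfderiv (I.prod 𝓘(ℝ, F)) 𝓘(ℝ, V × F) φ z v) := fun z hzW hz v =>
    mfderiv_eq_fderiv_comp_mfderiv_extChartAt hz (hfz z hzW) v
  have hinv : ∀ z ∈ (chartAt (ModelProd H F) z₀).source,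
      (mfderiv (I.prod 𝓘(ℝ, F)) 𝓘(ℝ, V × F) φ z).IsInvertible := fun z hz =>
    isInvertible_mfderiv_extChartAt (by simpa using hz)
  have hgcrit : ∀ᶠ x in 𝓝 (extChartAt I c c), fderiv ℝ g (x, 0) = 0 := by
    have h1 : Filter.Tendsto (fun x : V => (x, (0 : F))) (𝓝 (extChartAt I c c)) (𝓝 (φ z₀)) := by
      rw [hφz₀]; exact (by fun_prop : Continuous fun x : V => (x, (0 : F))).tendsto _
    have h2 : ∀ᶠ x in 𝓝 (extChartAt I c c), x ∈ (extChartAt I c).target :=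
      extChartAt_target_mem_nhds c
    filter_upwards [h1.eventually htarget, h2] with x hx hxt
    have hx' : φ.symm (x, 0) ∈ (chartAt (ModelProd H F) z₀).source := by
      simpa [hφ] using φ.map_target hx
    have hxz : zeroSection F E ((extChartAt I c).symm x) = φ.symm (x, 0) := by
      have hz : zeroSection F E ((extChartAt I c).symm x) ∈ (chartAt (ModelProd H F) z₀).source := by
        rw [hφ, FiberBundle.extChartAt_target] at hx
        have hxs := (extChartAt I c).map_target hxt
        rw [extChartAt_source] at hxs
        exact mem_chartAt_totalSpace_source.2 ⟨hx.1.2, hxs⟩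
      rw [← φ.left_inv (x := zeroSection F E ((extChartAt I c).symm x)) (by simpa [hφ] using hz)]
      refine congrArg φ.symm ((extChartAt_totalSpace_zeroSection hz).trans ?_)
      exact Prod.ext ((extChartAt I c).right_inv hxt) rfl
    have hcr := hzero ((extChartAt I c).symm x)
    rw [hxz] at hcr
    refine ContinuousLinearMap.ext fun e => ?_
    obtain ⟨v, rfl⟩ := (hinv _ hx').surjective e
    have h3 := hdg _ hcr.1 hx' v
    rw [hcr.2, φ.right_inv hx] at h3
    exact h3.symm
  -- The coordinate Hessian is `hessian` at `z₀` by definition, the chart being the preferred one.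
  -- So `(0, w)` is tangent to a critical submanifold, which lies in the zero section.
  have hnd : ∀ w : F, (∀ e, fderiv ℝ (fderiv ℝ g) (extChartAt I c c, 0) (0, w) e = 0) → w = 0 := by
    intro w hw
    obtain ⟨S, hS, -, -, -, hnull⟩ := hf.exists_submanifolds
    obtain ⟨i, hi⟩ := mem_iUnion.1 (hS ▸ hzero c)
    rw [← hφz₀] at hw
    have hSi : S i ⊆ range (zeroSection F E) := by
      rw [← hcrit, hS]; exact subset_iUnion S i
    exact snd_eq_zero_of_mem_tangentVectors hSi
      ((hnull i z₀ hi (show V × F from (0, w))).1 hw)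
  obtain ⟨K, hK⟩ := exists_vertical_proj_of_nondegenerate hgs (hφz₀ ▸ hs) hgcrit hnd
  rw [← hφz₀] at hK
  have hev : ∀ᶠ z in 𝓝 z₀, (z ∈ W ∧ z ∈ (chartAt (ModelProd H F) z₀).source) ∧
      ContDiffAt ℝ ∞ K (φ z) ∧ (∀ e, (K (φ z) e).1 = 0) ∧ (∀ w, K (φ z) (0, w) = (0, w)) ∧
      ∀ e, fderiv ℝ g (φ z) (K (φ z) e) = fderiv ℝ g (φ z) e :=
    ((hW.eventually_mem (hzero c).1).and ((chartAt (ModelProd H F) z₀).open_source.eventually_mem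
      (mem_chart_source _ z₀))).and ((continuousAt_extChartAt z₀).eventually hK)
  obtain ⟨A, hA, hAo, hzA⟩ := eventually_nhds_iff.1 hev
  refine ⟨A, hAo, hzA, fun z hz => (hA z hz).1.1,
    chartEndomorphism (I.prod 𝓘(ℝ, F)) z₀ K, fun z hz => ?_⟩
  obtain ⟨⟨hzW, hzs⟩, hKs, hKv, hKw, hKg⟩ := hA z hz
  refine ⟨⟨fun v => ?_, fun v hv => ?_, fun v => ?_⟩, contMDiffAt_chartEndomorphism hzs hKs⟩
  · rw [mem_verticalSpace_iff hzs, mfderiv_extChartAt_chartEndomorphism hzs]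
    exact hKv _
  · rw [mem_verticalSpace_iff hzs] at hv
    apply (hinv z hzs).injective
    rw [mfderiv_extChartAt_chartEndomorphism hzs]
    have h := hKw (mfderiv (I.prod 𝓘(ℝ, F)) 𝓘(ℝ, V × F) φ z v).2
    rwa [← hv] at h
  · rw [hdg z hzW hzs, hdg z hzW hzs, mfderiv_extChartAt_chartEndomorphism hzs]
    exact hKg _

end VerticalProjection

/-! ### Gluing by a partition of unity on the base. -/

section Gluing

variable {V : Type*} [NormedAddCommGroup V] [NormedSpace ℝ V]
  {H : Type*} [TopologicalSpace H] {I : ModelWithCorners ℝ V H}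
  {C : Type*} [TopologicalSpace C] [ChartedSpace H C]
  {F : Type*} [NormedAddCommGroup F] [NormedSpace ℝ F]
  {E : C → Type*} [TopologicalSpace (TotalSpace F E)]
  [∀ x, TopologicalSpace (E x)] [FiberBundle F E]
  [∀ x, AddCommGroup (E x)] [∀ x, Module ℝ (E x)] [VectorBundle ℝ F E]
  [IsManifold I ∞ C] [ContMDiffVectorBundle ∞ F E I]

theorem IsVerticalProjectionPreserving.sum {f : TotalSpace F E → ℝ} {z : TotalSpace F E}
    {ι : Type*} {s : Finset ι} {r : ι → ℝ}
    {κ : ι → TangentSpace (I.prod 𝓘(ℝ, F)) z →L[ℝ] TangentSpace (I.prod 𝓘(ℝ, F)) z}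
    (hr : ∑ i ∈ s, r i = 1) (hκ : ∀ i ∈ s, IsVerticalProjectionPreserving I f z (κ i)) :
    IsVerticalProjectionPreserving I f z (∑ i ∈ s, r i • κ i) where
  mem_vertical v := by
    rw [sum_apply]
    exact Submodule.sum_mem _ fun i hi => Submodule.smul_mem _ _ ((hκ i hi).mem_vertical v)
  apply_vertical v hv := by
    rw [sum_apply, Finset.sum_congr rfl (g := fun i => r i • v) fun i hi => by
      rw [smul_apply, (hκ i hi).apply_vertical v hv],
      ← Finset.sum_smul, hr, one_smul]
  mfderiv_apply v := by
    rw [sum_apply, map_sum, Finset.sum_congr rfl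
      (g := fun i => r i • mfderiv (I.prod 𝓘(ℝ, F)) 𝓘(ℝ, ℝ) f z v) fun i hi => by
      rw [smul_apply, map_smul, (hκ i hi).mfderiv_apply v],
      ← Finset.sum_smul, hr, one_smul]

theorem exists_verticalProjection_of_local [FiniteDimensional ℝ V] [T2Space C] [SigmaCompactSpace C]
    {f : TotalSpace F E → ℝ} {A : C → Set (TotalSpace F E)} (hA : ∀ c, IsOpen (A c))
    (hcA : ∀ c, zeroSection F E c ∈ A c)
    {κ : C → ∀ z : TotalSpace F E,
        TangentSpace (I.prod 𝓘(ℝ, F)) z →L[ℝ] TangentSpace (I.prod 𝓘(ℝ, F)) z}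
    (hκ : ∀ c, ∀ z ∈ A c, IsVerticalProjectionPreserving I f z (κ c z) ∧
      ContMDiffAt (I.prod 𝓘(ℝ, F)) ((I.prod 𝓘(ℝ, F)).prod 𝓘(ℝ, V × F →L[ℝ] V × F)) ∞
        (fun z => TotalSpace.mk' (V × F →L[ℝ] V × F)
          (E := fun z : TotalSpace F E => TangentSpace (I.prod 𝓘(ℝ, F)) z →L[ℝ]
            TangentSpace (I.prod 𝓘(ℝ, F)) z) z (κ c z)) z) :
    ∃ B : Set (TotalSpace F E), IsOpen B ∧ range (zeroSection F E) ⊆ B ∧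
      ∃ κ' : ∀ z : TotalSpace F E,
        TangentSpace (I.prod 𝓘(ℝ, F)) z →L[ℝ] TangentSpace (I.prod 𝓘(ℝ, F)) z,
        ∀ z ∈ B, IsVerticalProjectionPreserving I f z (κ' z) ∧
          ContMDiffAt (I.prod 𝓘(ℝ, F)) ((I.prod 𝓘(ℝ, F)).prod 𝓘(ℝ, V × F →L[ℝ] V × F)) ∞
            (fun z => TotalSpace.mk' (V × F →L[ℝ] V × F)
              (E := fun z : TotalSpace F E => TangentSpace (I.prod 𝓘(ℝ, F)) z →L[ℝ]
                TangentSpace (I.prod 𝓘(ℝ, F)) z) z (κ' z)) z := by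
  have hzc : Continuous (zeroSection F E) :=
    (contMDiff_zeroSection (n := ∞) (IB := I) ℝ E).continuous
  have hpc : Continuous (π F E) := FiberBundle.continuous_proj F E
  obtain ⟨ρ, hρ⟩ := SmoothPartitionOfUnity.exists_isSubordinate I (isClosed_univ (X := C))
    (fun c => zeroSection F E ⁻¹' A c) (fun c => (hA c).preimage hzc)
    fun c _ => mem_iUnion.2 ⟨c, hcA c⟩
  have hlf : LocallyFinite fun c => π F E ⁻¹' tsupport (ρ c) :=
    ρ.locallyFinite.closure.preimage_continuous hpc
  -- The points lying in `A c` for every `c` whose pulled-back support contains them. Local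
  -- finiteness makes the removed union closed.
  have hBo : IsOpen (⋃ c, π F E ⁻¹' tsupport (ρ c) \ A c)ᶜ :=
    ((hlf.subset fun c => sdiff_subset).isClosed_iUnion fun c =>
      ((isClosed_tsupport _).preimage hpc).sdiff (hA c)).isOpen_compl
  have hB : ∀ z ∈ (⋃ c, π F E ⁻¹' tsupport (ρ c) \ A c)ᶜ, ∀ c, z.proj ∈ tsupport (ρ c) →
      z ∈ A c := fun z hz c hc => by_contra fun h => hz (mem_iUnion.2 ⟨c, hc, h⟩)
  refine ⟨_, hBo, ?_, fun z => ∑ᶠ c, ρ c z.proj • κ c z, fun z hz => ⟨?_, ?_⟩⟩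
  · rintro _ ⟨x, rfl⟩ hx
    obtain ⟨c, hc, hc'⟩ := mem_iUnion.1 hx
    exact hc' (hρ c hc)
  · have hfin : (Function.support fun c => ρ c z.proj).Finite := ρ.locallyFinite.point_finite z.proj
    have hsub : (Function.support fun c => ρ c z.proj • κ c z) ⊆ hfin.toFinset := fun c hc => by
      rw [Finite.coe_toFinset]
      exact fun h0 => hc (by simp only [h0, zero_smul])
    beta_reduce
    rw [finsum_eq_sum_of_support_subset _ hsub]
    refine IsVerticalProjectionPreserving.sum ?_ fun c hc => ?_
    · rw [← ρ.sum_eq_one (mem_univ z.proj), finsum_eq_sum_of_support_subset _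
        hfin.coe_toFinset.ge]
    · exact (hκ c z (hB z hz c (subset_tsupport _ (hfin.mem_toFinset.1 hc)))).1
  · refine ContMDiffAt.finsum_section_of_locallyFinite
      (t := fun c z => ρ c z.proj • κ c z) (hlf.subset fun c z hz' => ?_) fun c => ?_
    · exact subset_tsupport _ fun h0 => hz' (by simp only [h0, zero_smul])
    · by_cases hc : z.proj ∈ tsupport (ρ c)
      · exact ContMDiffAt.smul_section
          ((ρ c).contMDiff.contMDiffAt.comp z (contMDiff_proj E z))
          (hκ c z (hB z hz c hc)).2
      · refine (contMDiff_zeroSection ℝ (fun z : TotalSpace F E =>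
          TangentSpace (I.prod 𝓘(ℝ, F)) z →L[ℝ] TangentSpace (I.prod 𝓘(ℝ, F)) z) z
          ).congr_of_eventuallyEq ?_
        filter_upwards [((isClosed_tsupport (ρ c)).isOpen_compl.preimage hpc).mem_nhds hc] with y hy
        have h0 : ρ c y.proj = 0 := image_eq_zero_of_notMem_tsupport hy
        simp only [h0, zero_smul]
        rfl

end Gluing

end

theorem mainTheorem8 {n : ℕ}
    {C : Type*} [TopologicalSpace C] [T2Space C] [SigmaCompactSpace C]
    [ChartedSpace (EuclideanSpace ℝ (Fin n)) C] [IsManifold (𝓡 n) ∞ C]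
    {F : Type*} [NormedAddCommGroup F] [NormedSpace ℝ F] [FiniteDimensional ℝ F]
    {E : C → Type*} [∀ x, AddCommGroup (E x)] [∀ x, Module ℝ (E x)]
    [∀ x, TopologicalSpace (E x)] [TopologicalSpace (TotalSpace F E)]
    [FiberBundle F E] [VectorBundle ℝ F E] [ContMDiffVectorBundle ∞ F E (𝓡 n)]
    (W : Set (TotalSpace F E)) (hW : IsOpen W) (hCW : range (zeroSection F E) ⊆ W)
    (f : TotalSpace F E → ℝ)
    (hf : IsMorseBottOn ((𝓡 n).prod 𝓘(ℝ, F)) f W)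
    (hzero : {z ∈ W | f z = 0} = range (zeroSection F E))
    (hcrit : criticalSet ((𝓡 n).prod 𝓘(ℝ, F)) f W = range (zeroSection F E)) :
    ∃ A : Set (TotalSpace F E), IsOpen A ∧ range (zeroSection F E) ⊆ A ∧ A ⊆ W ∧
      ∃ κ : LocalEhresmannConnection (𝓡 n) F A, ∀ z ∈ A,
        κ.horizontalSpace z ≤
          LinearMap.ker (mfderiv ((𝓡 n).prod 𝓘(ℝ, F)) 𝓘(ℝ, ℝ) f z).toLinearMap := by
  choose A hAo hcA _ κ hκ using fun c : C => exists_local_verticalProjection hW hf hcrit c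
  obtain ⟨B, hBo, hB, κ', hκ'⟩ := exists_verticalProjection_of_local hAo hcA hκ
  refine ⟨B ∩ W, hBo.inter hW, subset_inter hB hCW, inter_subset_right,
    ⟨κ', fun p hp => ?_, fun z hz => (hκ' z hz.1).1.mem_vertical,
      fun z hz => (hκ' z hz.1).1.apply_vertical⟩, fun z hz v hv => ?_⟩
  · refine ContMDiffAt.contMDiffWithinAt ?_
    exact ContMDiffAt.clm_bundle_apply (b := TotalSpace.proj) (ϕ := fun p => κ' p.proj)
      (v := fun p => p.snd)
      ((hκ' p.proj hp.1).2.comp p (contMDiffAt_proj (TangentSpace ((𝓡 n).prod 𝓘(ℝ, F)))))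
      contMDiffAt_id
  · have hv' : κ' z v = 0 := hv
    have h := (hκ' z hz.1).1.mfderiv_apply v
    rw [hv', map_zero] at h
    exact h.symm
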